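/- Conventions. Let $G$ be a connected real Lie group with Lie algebra $\mathfrak g$ (left-invariant vector fields), where $\mathfrak g$ is a finite-dimensional Lie bialgebra with cobracket $\delta$; let $\mathfrak g^*$ carry the dual bracket $\langle[\xi,\eta],X\rangle=\langle\xi\otimes\eta,\delta(X)\rangle$ and let $\mathfrak d=\mathfrak g\oplus\mathfrak g^*$ be the double Lie algebra. Let $G^*$ and $D$ be Lie groups with Lie algebras $\mathfrak g^*$ and $\mathfrak d$, together with Lie group morphisms $G\to D$, $G^*\to D$ integrating the inclusions. The infinitesimal dressing action of $\mathfrak g$ on $G^*$ is $\ell_X(u)=dR_u\big(\mathrm{pr}_{\mathfrak g^*}(\mathrm{Ad}_uX)\big)$, i.e. the linearization at $g=e$ of the factorization $ug={}^{u}g\,u^{g}$ in $D$ (${}^{u}g\in G$, $u^g\in G^*$). The dressing action is said to be global if there is a smooth right action $(u,g)\mapsto u^g$ of $G$ on $G^*$ such that, for every $u$ and all $g$ near $e$, $ug={}^{u}g\,u^{g}$ in $D$ with ${}^ug\in G$ depending smoothly on $g$ near $e$. For a Poisson structure $\pi$ put $\pi^\sharp(\alpha)=\pi(\alpha,\cdot)$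 and $[\alpha,\beta]_{\pi}=\mathcal L_{\pi^\sharp\alpha}\beta-\mathcal L_{\pi^\sharp\beta}\alpha-d(\pi(\alpha,\beta))$. Fix a sign $\varepsilon\in\{1,-1\}$. A dressing generator with respect to a Poisson structure $\pi_{G^*}$ on $G^*$ is a linear map $X\mapsto\alpha_X$ from $\mathfrak g$ to smooth one-forms on an open dense set $U\subseteq G^*$ such that on $U$ $$\ell_X=\pi_{G^*}^\sharp(\alpha_X),\qquad \alpha_{[X,Y]}=[\alpha_X,\alpha_Y]_{\pi_{G^*}},\qquad d\alpha_X=\varepsilon\,(\alpha\wedge\alpha)(\delta(X)),$$ where $(\alpha\wedge\alpha)(\delta(X))$ is the two-form $\sum_{i,j}\delta^{ij}\,\alpha_{X_i}\otimes\alpha_{X_j}$ if $\delta(X)=\sum_{i,j}\delta^{ij}X_i\otimes X_j$. Let $\pi_G$ be a multiplicative Poisson structure on $G$ with linearization $\delta$ at $e$, and let $(M,\pi)$ be a Poisson manifold with a smooth left $G$-action. A Lie algebra morphism $\varphi:\mathfrak g\to\Gamma^\infty(TM)$ is a Hamiltonian action with momentum map $J:M\to G^*$ ($J$ smooth) if: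 $\varphi$ is generated by the $G$-action, $\varphi(X)(x)=\frac{d}{dt}\big|_{0}\exp(-tX)\cdot x$; the action map $(G,\pi_G)\times(M,\pi)\to(M,\pi)$ is Poisson; $\varphi(X)=\pi^\sharp(J^*\alpha_X)$ on $J^{-1}(U)$ for all $X$, where $\alpha$ is a dressing generator with respect to some Poisson structure on $G^*$; and $J$ is $\ell$-equivariant, $dJ_x(\varphi(X)(x))=\ell_X(J(x))$ for all $X$ and $x\in M$. Theorem. Let $\varphi$ be a Hamiltonian action with momentum map $J:M\to G^*$, and let $\Phi:\mathcal U(\mathfrak g)\times C^\infty(M)\to C^\infty(M)$ be the associated Hopf algebra action, determined by $\Phi(X)=\mathcal L_{\varphi(X)}$ for $X\in\mathfrak g$. (i) There is a (unique) action $\Lambda$ of the algebra $\mathcal U(\mathfrak g)$ on $C^\infty(G^*)$ with $\Lambda(X)=\mathcal L_{\ell_X}$ for $X\in\mathfrak g$, and the algebra morphism $J^*:C^\infty(G^*)\to C^\infty(M)$ satisfies $\Phi(a,J^*f)=J^*(\Lambda(a,f))$ for all $a\in\mathcal U(\mathfrak g)$ and $f\in C^\infty(G^*)$; so $J^*$ is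 a morphism of $\mathcal U(\mathfrak g)$-module algebras. (ii) Identify the completed tensor product $C^\infty(N)\,\hat\otimes\, C^\infty(G)$ with $C^\infty(N\times G)$ for $N=M$ and $N=G^*$. A right coaction $\delta_A$ of $C^\infty(G)$ on $C^\infty(N)$ is dual to an action $A$ of $\mathcal U(\mathfrak g)$ if it is an algebra morphism, counital and coassociative, with $A(X,f)=(\mathrm{id}\otimes\langle X,\cdot\rangle)\delta_A(f)$, $\langle X,h\rangle=dh_e(X)$, for all $X\in\mathfrak g$. The coaction $(\delta_\Phi f)(x,g)=f(g^{-1}\cdot x)$ is dual to $\Phi$. If the dressing action is global, the coaction $(\delta_\Lambda f)(u,g)=f(u^g)$ is dual to $\Lambda$, and $$\delta_\Phi\circ J^*=(J^*\otimes\mathrm{id})\circ\delta_\Lambda ,$$ where $J^*\otimes\mathrm{id}$ is the pullback along $J\times\mathrm{id}_G$; so $J^*$ is a morphism of $C^\infty(G)$-comodule algebras. -/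

import Mathlib

open scoped Manifold ContDiff TensorProduct
open VectorField

noncomputable section

attribute [local instance] LieRing.ofAssociativeRing

/-- A smooth real Lie group is regular enough for its tangent space at the unit to carry the Lie
algebra structure `GroupLieAlgebra`. -/
instance instLieGroupMinSmoothness {E H G : Type*} [NormedAddCommGroup E] [NormedSpace ℝ E]
    [TopologicalSpace H] (I : ModelWithCorners ℝ E H) [TopologicalSpace G] [ChartedSpace H G]
    [Group G] [LieGroup I ∞ G] : LieGroup I (minSmoothness ℝ 3) G := by
  rw [minSmoothness_of_isRCLikeNormedField]
  infer_instance

/-! ### Lie bialgebras, their duals and doubles -/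

section LieBialgebra

variable {L : Type*} [LieRing L] [LieAlgebra ℝ L]

/-- `⟨ξ ⊗ η, t⟩` for `t ∈ L ⊗ L` and linear forms `ξ`, `η` on `L`. -/
def tensorPairing (ξ η : Module.Dual ℝ L) : L ⊗[ℝ] L →ₗ[ℝ] ℝ :=
  LinearMap.mul' ℝ ℝ ∘ₗ TensorProduct.map ξ η

/-- The bracket on `L*` dual to a cobracket `δ`: `[ξ, η](X) = ⟨ξ ⊗ η, δ X⟩`. -/
def dualBracket (δ : L →ₗ[ℝ] L ⊗[ℝ] L) (ξ η : Module.Dual ℝ L) : Module.Dual ℝ L :=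
  tensorPairing ξ η ∘ₗ δ

/-- A Lie bialgebra structure on a Lie algebra `L`: a skew-symmetric cobracket which is a
`1`-cocycle and whose transpose is a Lie bracket on `L*`. -/
structure LieBialgebra (L : Type*) [LieRing L] [LieAlgebra ℝ L] where
  cobracket : L →ₗ[ℝ] L ⊗[ℝ] L
  skew : ∀ X, TensorProduct.comm ℝ L L (cobracket X) = -cobracket X
  cocycle : ∀ X Y, cobracket ⁅X, Y⁆ = ⁅X, cobracket Y⁆ - ⁅Y, cobracket X⁆
  jacobi : ∀ ξ η ζ : Module.Dual ℝ L,
    dualBracket cobracket ξ (dualBracket cobracket η ζ) +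
      dualBracket cobracket η (dualBracket cobracket ζ ξ) +
      dualBracket cobracket ζ (dualBracket cobracket ξ η) = 0

/-- The coadjoint action of `L` on `L*`: `(ad*_X ξ)(Y) = -ξ([X, Y])`. -/
def coadjoint (X : L) (ξ : Module.Dual ℝ L) : Module.Dual ℝ L :=
  -(ξ ∘ₗ (LieAlgebra.ad ℝ L X : L →ₗ[ℝ] L))

/-- The coadjoint action of `L*` on `L = (L*)*`: `η(ad*_ξ X) = -[ξ, η](X)`, that is
`ad*_ξ X = -(ξ ⊗ id)(δ X)`. -/
def dualCoadjoint (δ : L →ₗ[ℝ] L ⊗[ℝ] L) (ξ : Module.Dual ℝ L) (X : L) : L :=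
  -(TensorProduct.lid ℝ L (TensorProduct.map ξ LinearMap.id (δ X)))

/-- The bracket of the double `𝔡 = L ⊕ L*`:
`[X + ξ, Y + η] = ([X, Y] + ad*_ξ Y - ad*_η X) + ([ξ, η] + ad*_X η - ad*_Y ξ)`. -/
def doubleBracket (δ : L →ₗ[ℝ] L ⊗[ℝ] L) (a b : L × Module.Dual ℝ L) : L × Module.Dual ℝ L :=
  (⁅a.1, b.1⁆ + dualCoadjoint δ a.2 b.1 - dualCoadjoint δ b.2 a.1,
    dualBracket δ a.2 b.2 + coadjoint a.1 b.2 - coadjoint b.1 a.2)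

end LieBialgebra

/-! ### Functions, one-forms, Poisson structures and infinitesimal actions on a manifold -/

section Manifold

variable {m : ℕ} {M : Type*} [TopologicalSpace M] [ChartedSpace (EuclideanSpace ℝ (Fin m)) M]

/-- The Lie derivative `(L_V f)(x) = df_x(V_x)` of a function along a vector field. -/
def lieDeriv (V : Π x : M, TangentSpace (𝓡 m) x) (f : M → ℝ) : M → ℝ :=
  fun x => mvfderiv (𝓡 m) f x (V x)

/-- A vector field is smooth. -/
def SmoothVectorField (V : Π x : M, TangentSpace (𝓡 m) x) [IsManifold (𝓡 m) ∞ M] : Prop :=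
  ContMDiff (𝓡 m) (𝓡 m).tangent ∞
    (fun x => (⟨x, V x⟩ : TangentBundle (𝓡 m) M))

/-- A one-form is smooth on `U`, as a section of the cotangent bundle. -/
def SmoothOneFormOn (U : Set M) (α : Π x : M, (TangentSpace (𝓡 m) x →L[ℝ] ℝ))
    [IsManifold (𝓡 m) ∞ M] : Prop :=
  ContMDiffOn (𝓡 m) ((𝓡 m).prod 𝓘(ℝ, EuclideanSpace ℝ (Fin m) →L[ℝ] ℝ)) ∞
    (fun x => Bundle.TotalSpace.mk' (EuclideanSpace ℝ (Fin m) →L[ℝ] ℝ)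
      (E := fun x : M => TangentSpace (𝓡 m) x →L[ℝ] Bundle.Trivial M ℝ x) x (α x)) U

/-- The exterior derivative of a one-form, evaluated on two vector fields:
`dα(V, W) = V(α(W)) - W(α(V)) - α([V, W])`. -/
def extDerivOneForm (α : Π x : M, (TangentSpace (𝓡 m) x →L[ℝ] ℝ))
    (V W : Π x : M, TangentSpace (𝓡 m) x) (x : M) : ℝ :=
  lieDeriv V (fun y => α y (W y)) x - lieDeriv W (fun y => α y (V y)) x
    - α x (mlieBracket (𝓡 m) V W x)

/-- A Poisson structure, given by the bundle map `π♯ : T*M → TM` of its bivector field `π`, with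
the convention `π(α, β) = β(π♯ α)`. Smoothness and the Jacobi identity are those of the
bracket `{f, g} = π(df, dg)`. -/
structure PoissonStructure (m : ℕ) (M : Type*) [TopologicalSpace M]
    [ChartedSpace (EuclideanSpace ℝ (Fin m)) M] where
  sharp : Π x : M, (TangentSpace (𝓡 m) x →L[ℝ] ℝ) →ₗ[ℝ] TangentSpace (𝓡 m) x
  skew : ∀ (x : M) (α β : TangentSpace (𝓡 m) x →L[ℝ] ℝ), β (sharp x α) = -α (sharp x β)
  smooth : ∀ f g : C^∞⟮𝓡 m, M; ℝ⟯, ContMDiff (𝓡 m) 𝓘(ℝ, ℝ) ∞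
    (fun x => mvfderiv (𝓡 m) g x (sharp x (mvfderiv (𝓡 m) f x)))
  jacobi : ∀ f g h : C^∞⟮𝓡 m, M; ℝ⟯,
    let br : (M → ℝ) → (M → ℝ) → M → ℝ :=
      fun f g x => mvfderiv (𝓡 m) g x (sharp x (mvfderiv (𝓡 m) f x))
    br f (br g h) + br g (br h f) + br h (br f g) = 0

namespace PoissonStructure

variable (π : PoissonStructure m M)

/-- The Poisson bracket `{f, g} = π(df, dg)`. -/
def bracket (f g : M → ℝ) : M → ℝ :=
  fun x => mvfderiv (𝓡 m) g x (π.sharp x (mvfderiv (𝓡 m) f x))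

/-- The vector field `π♯ α`. -/
def sharpField (α : Π x : M, (TangentSpace (𝓡 m) x →L[ℝ] ℝ)) (x : M) : TangentSpace (𝓡 m) x :=
  π.sharp x (α x)

/-- The Lie derivative of a one-form, `(L_V β)(W) = V(β(W)) - β([V, W])`. -/
def _root_.lieDerivOneForm (V : Π x : M, TangentSpace (𝓡 m) x)
    (β : Π x : M, (TangentSpace (𝓡 m) x →L[ℝ] ℝ)) (W : Π x : M, TangentSpace (𝓡 m) x)
    (x : M) : ℝ :=
  lieDeriv V (fun y => β y (W y)) x - β x (mlieBracket (𝓡 m) V W x)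

/-- The bracket of one-forms `[α, β]_π = L_{π♯ α} β - L_{π♯ β} α - d(π(α, β))`, evaluated on a
vector field. -/
def formBracket (α β : Π x : M, (TangentSpace (𝓡 m) x →L[ℝ] ℝ))
    (W : Π x : M, TangentSpace (𝓡 m) x) (x : M) : ℝ :=
  lieDerivOneForm (π.sharpField α) β W x - lieDerivOneForm (π.sharpField β) α W x
    - lieDeriv W (fun y => β y (π.sharp y (α y))) x

end PoissonStructure

/-- An infinitesimal action of a Lie algebra `L` on `M`: a Lie algebra morphism from `L` to the
smooth vector fields on `M`, whose bracket is the commutator of Lie derivatives on functions. -/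
structure InfinitesimalAction (L : Type*) [LieRing L] [LieAlgebra ℝ L] (m : ℕ) (M : Type*)
    [TopologicalSpace M] [ChartedSpace (EuclideanSpace ℝ (Fin m)) M] [IsManifold (𝓡 m) ∞ M] where
  field : L →ₗ[ℝ] (Π x : M, TangentSpace (𝓡 m) x)
  smooth : ∀ X, SmoothVectorField (field X)
  lie : ∀ (X Y : L) (f : C^∞⟮𝓡 m, M; ℝ⟯),
    lieDeriv (field ⁅X, Y⁆) f =
      lieDeriv (field X) (lieDeriv (field Y) f) - lieDeriv (field Y) (lieDeriv (field X) f)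

theorem SmoothVectorField.contMDiff_lieDeriv [IsManifold (𝓡 m) ∞ M]
    {V : Π x : M, TangentSpace (𝓡 m) x} (hV : SmoothVectorField V) (f : C^∞⟮𝓡 m, M; ℝ⟯) :
    ContMDiff (𝓡 m) 𝓘(ℝ, ℝ) ∞ (lieDeriv V f) := by
  have h1 : ContMDiff (𝓡 m).tangent 𝓘(ℝ, ℝ).tangent ∞ (tangentMap (𝓡 m) 𝓘(ℝ, ℝ) f) :=
    f.contMDiff.contMDiff_tangentMap (by simp)
  have h2 := (contMDiff_snd_tangentBundle_modelSpace ℝ 𝓘(ℝ, ℝ) (n := ∞)).comp (h1.comp hV)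
  exact h2

/-- The Lie derivative along a smooth vector field, as an endomorphism of `C^∞(M)`. -/
def lieDerivEnd [IsManifold (𝓡 m) ∞ M] (V : Π x : M, TangentSpace (𝓡 m) x)
    (hV : SmoothVectorField V) : Module.End ℝ C^∞⟮𝓡 m, M; ℝ⟯ where
  toFun f := ⟨lieDeriv V f, hV.contMDiff_lieDeriv f⟩
  map_add' f g := by
    ext x
    have hf := f.contMDiff.mdifferentiable (by simp) x
    have hg := g.contMDiff.mdifferentiable (by simp) x
    have := congrArg (fun A => A (V x)) (mvfderiv_add hf hg)
    exact this
  map_smul' c f := by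
    ext x
    have hf := f.contMDiff.mdifferentiable (by simp) x
    have := congrArg (fun A => A (V x))
      (mvfderiv_smul (a := fun _ : M => c) (mdifferentiableAt_const) hf)
    simpa [mvfderiv_const] using! this

namespace InfinitesimalAction

variable {L : Type*} [LieRing L] [LieAlgebra ℝ L] [IsManifold (𝓡 m) ∞ M]

/-- The action `X ↦ L_{φ(X)}` of the Lie algebra on `C^∞(M)` by derivations. -/
def toEnd (φ : InfinitesimalAction L m M) : L →ₗ⁅ℝ⁆ Module.End ℝ C^∞⟮𝓡 m, M; ℝ⟯ where
  toFun X := lieDerivEnd (φ.field X) (φ.smooth X)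
  map_add' X Y := by
    ext f x
    change mvfderiv (𝓡 m) f x (φ.field (X + Y) x) = _
    rw [map_add]
    exact map_add (mvfderiv (𝓡 m) f x) _ _
  map_smul' c X := by
    ext f x
    change mvfderiv (𝓡 m) f x (φ.field (c • X) x) = _
    rw [map_smul]
    exact map_smul (mvfderiv (𝓡 m) f x) _ _
  map_lie' {X Y} := by
    ext f x
    exact congrFun (φ.lie X Y f) x

/-- The Hopf algebra action of `U(L)` on `C^∞(M)` with `Φ(X) = L_{φ(X)}` for `X ∈ L`. -/
def hopfAction (φ : InfinitesimalAction L m M) :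
    UniversalEnvelopingAlgebra ℝ L →ₐ[ℝ] Module.End ℝ C^∞⟮𝓡 m, M; ℝ⟯ :=
  UniversalEnvelopingAlgebra.lift ℝ φ.toEnd

end InfinitesimalAction

end Manifold

/-- The pullback `h* : C^∞(N) → C^∞(M)` of functions along a smooth map, an algebra morphism. -/
def pullbackHom {E E' H H' M N : Type*} [NormedAddCommGroup E] [NormedSpace ℝ E]
    [NormedAddCommGroup E'] [NormedSpace ℝ E'] [TopologicalSpace H] [TopologicalSpace H']
    {I : ModelWithCorners ℝ E H} {I' : ModelWithCorners ℝ E' H'}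
    [TopologicalSpace M] [ChartedSpace H M] [TopologicalSpace N] [ChartedSpace H' N]
    (h : C^∞⟮I, M; I', N⟯) : C^∞⟮I', N; ℝ⟯ →ₐ[ℝ] C^∞⟮I, M; ℝ⟯ where
  toFun f := f.comp h
  map_one' := rfl
  map_mul' _ _ := rfl
  map_zero' := rfl
  map_add' _ _ := rfl
  commutes' _ := rfl

/-! ### The double of a Poisson Lie group and the dressing action -/

section Dressing

variable (n : ℕ) (G Gs D : Type*)
  [TopologicalSpace G] [ChartedSpace (EuclideanSpace ℝ (Fin n)) G] [Group G] [LieGroup (𝓡 n) ∞ G]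
  [TopologicalSpace Gs] [ChartedSpace (EuclideanSpace ℝ (Fin n)) Gs] [Group Gs]
  [LieGroup (𝓡 n) ∞ Gs]
  [TopologicalSpace D] [ChartedSpace (EuclideanSpace ℝ (Fin (2 * n))) D] [Group D]
  [LieGroup (𝓡 (2 * n)) ∞ D]

/-- A Lie bialgebra structure on the Lie algebra `𝔤` of `G`, such that `Gs` (written `G*`) is a
Lie group of `𝔤*` and `D` a Lie group of the double `𝔡 = 𝔤 ⊕ 𝔤*`, with Lie group morphisms
`G → D` and `G* → D` that integrate the inclusions `𝔤 → 𝔡` and `𝔤* → 𝔡`. -/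
structure DoubleGroup where
  bialgebra : LieBialgebra (GroupLieAlgebra (𝓡 n) G)
  dualEquiv : GroupLieAlgebra (𝓡 n) Gs ≃ₗ[ℝ] Module.Dual ℝ (GroupLieAlgebra (𝓡 n) G)
  dualEquiv_lie : ∀ ξ η : GroupLieAlgebra (𝓡 n) Gs,
    dualEquiv ⁅ξ, η⁆ = dualBracket bialgebra.cobracket (dualEquiv ξ) (dualEquiv η)
  doubleEquiv : GroupLieAlgebra (𝓡 (2 * n)) D ≃ₗ[ℝ]
    GroupLieAlgebra (𝓡 n) G × Module.Dual ℝ (GroupLieAlgebra (𝓡 n) G)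
  doubleEquiv_lie : ∀ a b : GroupLieAlgebra (𝓡 (2 * n)) D,
    doubleEquiv ⁅a, b⁆ = doubleBracket bialgebra.cobracket (doubleEquiv a) (doubleEquiv b)
  inl : G →* D
  inl_smooth : ContMDiff (𝓡 n) (𝓡 (2 * n)) ∞ inl
  inl_deriv : ∀ X : GroupLieAlgebra (𝓡 n) G,
    doubleEquiv (mfderiv (𝓡 n) (𝓡 (2 * n)) inl 1 X) = (X, 0)
  inr : Gs →* D
  inr_smooth : ContMDiff (𝓡 n) (𝓡 (2 * n)) ∞ inr
  inr_deriv : ∀ ξ : GroupLieAlgebra (𝓡 n) Gs,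
    doubleEquiv (mfderiv (𝓡 n) (𝓡 (2 * n)) inr 1 ξ) = (0, dualEquiv ξ)

variable {n G Gs D}

/-- `π` is a Poisson Lie group structure on `G` (the multiplication is a Poisson map) whose
linearization at the unit is the cobracket of the Lie bialgebra `𝔤`. -/
structure IsPoissonLie (b : LieBialgebra (GroupLieAlgebra (𝓡 n) G))
    (π : PoissonStructure n G) : Prop where
  multiplicative : ∀ (f h : C^∞⟮𝓡 n, G; ℝ⟯) (g k : G),
    π.bracket f h (g * k) =
      π.bracket (fun x => f (g * x)) (fun x => h (g * x)) k +
      π.bracket (fun x => f (x * k)) (fun x => h (x * k)) g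
  linearization : ∀ (f h : C^∞⟮𝓡 n, G; ℝ⟯) (X : GroupLieAlgebra (𝓡 n) G),
    mvfderiv (𝓡 n) (π.bracket f h) 1 X =
      tensorPairing (L := GroupLieAlgebra (𝓡 n) G) (mvfderiv (𝓡 n) f 1).toLinearMap
        (mvfderiv (𝓡 n) h 1).toLinearMap
        (b.cobracket X)

namespace DoubleGroup

variable (B : DoubleGroup n G Gs D)

/-- The infinitesimal dressing action: differentiating the factorization
`u * exp (tX) = (ᵘexp (tX)) * u^exp (tX)` in `D` at `t = 0` gives
`ℓ_X(u) = dR_u (pr_{𝔤*} (Ad_u X))`, where `pr_{𝔤*} : 𝔡 = 𝔤 ⊕ 𝔤* → 𝔤*` is the projection. -/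
def dressingField (X : GroupLieAlgebra (𝓡 n) G) (u : Gs) : TangentSpace (𝓡 n) u :=
  let AdX : GroupLieAlgebra (𝓡 (2 * n)) D :=
    mfderiv (𝓡 (2 * n)) (𝓡 (2 * n)) (fun d : D => B.inr u * d * (B.inr u)⁻¹) 1
      (mfderiv (𝓡 n) (𝓡 (2 * n)) B.inl 1 X)
  let prAdX : GroupLieAlgebra (𝓡 n) Gs := B.dualEquiv.symm (B.doubleEquiv AdX).2
  mfderiv (𝓡 n) (𝓡 n) (fun v : Gs => v * u) 1 prAdX

/-- A global dressing action: a smooth right action `(u, g) ↦ u^g` of `G` on `G*` such that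
`u g = (ᵘg) (u^g)` in `D`, with `ᵘg ∈ G` smooth in `g`, for all `u ∈ G*` and all `g` near the
unit. -/
structure GlobalDressing where
  act : C^∞⟮(𝓡 n).prod (𝓡 n), Gs × G; 𝓡 n, Gs⟯
  act_one : ∀ u, act (u, 1) = u
  act_mul : ∀ u g h, act (u, g * h) = act (act (u, g), h)
  factorization : ∀ u, ∃ lam : G → G, ContMDiffAt (𝓡 n) (𝓡 n) ∞ lam 1 ∧
    ∀ᶠ g in nhds (1 : G), B.inr u * B.inl g = B.inl (lam g) * B.inr (act (u, g))

/-- For a `𝔤*`-valued one-form, seen as a linear map `α` from `𝔤` to one-forms, the element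
`X ↦ α_X(v)` of `𝔤*` at a tangent vector `v`. -/
def evalForms (α : GroupLieAlgebra (𝓡 n) G →ₗ[ℝ] (Π u : Gs, (TangentSpace (𝓡 n) u →L[ℝ] ℝ)))
    (u : Gs) (v : TangentSpace (𝓡 n) u) : Module.Dual ℝ (GroupLieAlgebra (𝓡 n) G) where
  toFun X := α X u v
  map_add' X Y := by simp
  map_smul' c X := by simp

/-- `α` (given on the open dense set `U ⊆ G*`) is a dressing generator with respect to the Poisson
structure `π` on `G*`: `ℓ_X = π♯(α_X)`, `α_{[X,Y]} = [α_X, α_Y]_π` and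
`dα_X = ε (α ∧ α ∘ δ)(X)` on `U`. The fixed sign `ε = ±1` absorbs the sign convention that relates
the cobracket to the Maurer-Cartan equation. -/
structure IsDressingGenerator (ε : ℤˣ) (π : PoissonStructure n Gs) (U : Set Gs)
    (α : GroupLieAlgebra (𝓡 n) G →ₗ[ℝ] (Π u : Gs, (TangentSpace (𝓡 n) u →L[ℝ] ℝ))) : Prop where
  isOpen : IsOpen U
  dense : Dense U
  smooth : ∀ X, SmoothOneFormOn U (α X)
  dressing : ∀ X, ∀ u ∈ U, B.dressingField X u = π.sharp u (α X u)
  lie : ∀ X Y, ∀ W : Π u : Gs, TangentSpace (𝓡 n) u, SmoothVectorField W → ∀ u ∈ U,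
    α ⁅X, Y⁆ u (W u) = π.formBracket (α X) (α Y) W u
  maurerCartan : ∀ X, ∀ V W : Π u : Gs, TangentSpace (𝓡 n) u, SmoothVectorField V →
    SmoothVectorField W → ∀ u ∈ U,
    extDerivOneForm (α X) V W u = (ε : ℤ) *
      tensorPairing
        (evalForms α u (V u)) (evalForms α u (W u))
        (B.bialgebra.cobracket X)

end DoubleGroup

/-! ### Hamiltonian actions -/

variable {m : ℕ} {M : Type*} [TopologicalSpace M] [ChartedSpace (EuclideanSpace ℝ (Fin m)) M]
  [IsManifold (𝓡 m) ∞ M] [MulAction G M] [ContMDiffSMul (𝓡 n) (𝓡 m) ∞ G M]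

/-- The action of the Poisson Lie group `(G, πG)` on `(M, π)` is Poisson: the action map
`G × M → M` is a Poisson map. -/
def IsPoissonAction (πG : PoissonStructure n G) (π : PoissonStructure m M) : Prop :=
  ∀ (f h : C^∞⟮𝓡 m, M; ℝ⟯) (g : G) (x : M),
    π.bracket f h (g • x) =
      π.bracket (fun y => f (g • y)) (fun y => h (g • y)) x +
      πG.bracket (fun k => f (k • x)) (fun k => h (k • x)) g

/-- The infinitesimal action `φ` of `𝔤` on `(M, π)` is Hamiltonian with momentum map `J : M → G*`:
it is generated by a Poisson action of `(G, πG)`, that is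
`φ(X)(x) = d/dt|₀ exp(-tX) • x`; `J` is a momentum map for the dressing generator `α`; and `J` is
equivariant with respect to the infinitesimal dressing action. -/
structure IsHamiltonian (B : DoubleGroup n G Gs D) (ε : ℤˣ) (πG : PoissonStructure n G)
    (πGs : PoissonStructure n Gs) (π : PoissonStructure m M) (U : Set Gs)
    (α : GroupLieAlgebra (𝓡 n) G →ₗ[ℝ] (Π u : Gs, (TangentSpace (𝓡 n) u →L[ℝ] ℝ)))
    (φ : InfinitesimalAction (GroupLieAlgebra (𝓡 n) G) m M)
    (J : C^∞⟮𝓡 m, M; 𝓡 n, Gs⟯) : Prop where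
  poissonLie : IsPoissonLie B.bialgebra πG
  fundamental : ∀ (X : GroupLieAlgebra (𝓡 n) G) (x : M),
    φ.field X x = mfderiv (𝓡 n) (𝓡 m) (fun g : G => g⁻¹ • x) 1 X
  poisson : IsPoissonAction πG π
  generator : B.IsDressingGenerator ε πGs U α
  momentum : ∀ (X : GroupLieAlgebra (𝓡 n) G) (x : M), J x ∈ U →
    φ.field X x = π.sharp x ((α X (J x)).comp (mfderiv (𝓡 m) (𝓡 n) J x))
  equivariant : ∀ (X : GroupLieAlgebra (𝓡 n) G) (x : M),
    mfderiv (𝓡 m) (𝓡 n) J x (φ.field X x) = B.dressingField X (J x)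

/-! ### Coactions of `C^∞(G)`

The completed tensor product `C^∞(M) ⊗ C^∞(G)` is `C^∞(M × G)`. -/

/-- An algebra morphism `δ : C^∞(M) → C^∞(M × G)` is the right Hopf algebra coaction of `C^∞(G)`
dual to a Hopf algebra action `A` of `U(𝔤)` on `C^∞(M)`: it satisfies `(id ⊗ ε) ∘ δ = id` and
`(δ ⊗ id) ∘ δ = (id ⊗ Δ) ∘ δ`, and `A(X) = (id ⊗ ⟨X, ·⟩) ∘ δ` for `X ∈ 𝔤`, where
`⟨X, h⟩ = dh_1(X)`. -/
structure IsDualCoaction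
    (A : UniversalEnvelopingAlgebra ℝ (GroupLieAlgebra (𝓡 n) G) →ₐ[ℝ]
      Module.End ℝ C^∞⟮𝓡 m, M; ℝ⟯)
    (δ : C^∞⟮𝓡 m, M; ℝ⟯ →ₐ[ℝ] C^∞⟮(𝓡 m).prod (𝓡 n), M × G; ℝ⟯) : Prop where
  counit : ∀ f x, δ f (x, 1) = f x
  coassoc : ∀ f x g h,
    δ (pullbackHom (ContMDiffMap.prodMk ContMDiffMap.id (ContMDiffMap.const h)) (δ f)) (x, g) =
      δ f (x, g * h)
  dual : ∀ (X : GroupLieAlgebra (𝓡 n) G) f x,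
    A (UniversalEnvelopingAlgebra.ι ℝ X) f x = mvfderiv (𝓡 n) (fun g : G => δ f (x, g)) 1 X

variable (n G m M) in
/-- The coaction `δ_Φ : C^∞(M) → C^∞(M × G)` of a left action of `G` on `M`:
`(δ_Φ f)(x, g) = f(g⁻¹ • x)`. -/
def actionCoaction : C^∞⟮𝓡 m, M; ℝ⟯ →ₐ[ℝ] C^∞⟮(𝓡 m).prod (𝓡 n), M × G; ℝ⟯ :=
  pullbackHom ⟨fun p : M × G => p.2⁻¹ • p.1,
    ContMDiff.smul (contMDiff_snd.inv) contMDiff_fst⟩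

/-- The coaction `δ_Λ : C^∞(G*) → C^∞(G* × G)` of the dressing action:
`(δ_Λ f)(u, g) = f(u^g)`. -/
def DoubleGroup.GlobalDressing.coaction {B : DoubleGroup n G Gs D} (R : B.GlobalDressing) :
    C^∞⟮𝓡 n, Gs; ℝ⟯ →ₐ[ℝ] C^∞⟮(𝓡 n).prod (𝓡 n), Gs × G; ℝ⟯ :=
  pullbackHom R.act

variable (n G) in
/-- The map `J* ⊗ id : C^∞(G*) ⊗ C^∞(G) → C^∞(M) ⊗ C^∞(G)`, which is the pullback along
`J × id`. -/
def pullbackTensorId (J : C^∞⟮𝓡 m, M; 𝓡 n, Gs⟯) :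
    C^∞⟮(𝓡 n).prod (𝓡 n), Gs × G; ℝ⟯ →ₐ[ℝ] C^∞⟮(𝓡 m).prod (𝓡 n), M × G; ℝ⟯ :=
  pullbackHom (ContMDiffMap.prodMk (J.comp ContMDiffMap.fst) ContMDiffMap.snd)

end Dressing

end

/-! The dressing fields are shadows of left-invariant fields on the double. Since `𝔡 = 𝔤 ⊕ 𝔤*`, the
map `(g, u) ↦ g u` from `G × G*` to `D` is a local diffeomorphism, although it need be neither
injective nor surjective. From `g u exp(tX) = g (u exp(tX) u⁻¹) u` and the splitting of `Ad_u X`,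
the left-invariant field of `X ∈ 𝔤` pulls back along it to a field whose `G*`-component at `(g, u)`
is `ℓ_X(u)`, independent of `g` (`liftField_snd`). Pullback along a local diffeomorphism preserves
brackets (`liftField_lie`) and so does projection to `G*`; hence `X ↦ ℓ_X` is a Lie algebra
morphism, and the universal property of `U(𝔤)` gives `Λ`.

Infinitesimal equivariance of `J` is the intertwining relation on generators, and it propagates
through products and sums (`hopfAction_pullbackHom`).

The coaction identity is global equivariance, `J(g⁻¹ x) = J(x)^g`. A global dressing action has
velocity `ℓ_X` at the unit (`mfderiv_act`), so the derivative of `h ↦ J(h⁻¹ x)^(h⁻¹)` vanishes at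
the unit for every `x`. Translation in `G` makes it vanish everywhere, and connectedness of `G`
makes this map constant (`equivariant`). -/

noncomputable section

set_option linter.unusedSectionVars false

/-! ### The Lie bracket of vector fields as a commutator of derivations -/

section Commutator

variable {E H M : Type*} [NormedAddCommGroup E] [NormedSpace ℝ E] [TopologicalSpace H]
  {I : ModelWithCorners ℝ E H} [TopologicalSpace M] [ChartedSpace H M]

/-- The directional derivative of a function read in the chart at `x`, along the pullback of a
vector field. -/
theorem fderivWithin_extChartAt_symm_mpullbackWithin [CompleteSpace E] [IsManifold I 1 M]
    {V : Π y : M, TangentSpace I y} {h : M → ℝ} {x : M} {y : E} (hy : y ∈ (extChartAt I x).target)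
    (hh : MDifferentiableAt I 𝓘(ℝ, ℝ) h ((extChartAt I x).symm y)) :
    fderivWithin ℝ (h ∘ (extChartAt I x).symm) (Set.range I) y
        (mpullbackWithin 𝓘(ℝ, E) I (extChartAt I x).symm V (Set.range I) y) =
      mvfderiv I h ((extChartAt I x).symm y) (V ((extChartAt I x).symm y)) := by
  have hyr : y ∈ Set.range I := extChartAt_target_subset_range x hy
  have hs := mdifferentiableWithinAt_extChartAt_symm (I := I) hy
  have h1 : mfderivWithin 𝓘(ℝ, E) 𝓘(ℝ, ℝ) (h ∘ (extChartAt I x).symm) (Set.range I) y =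
      (mfderiv I 𝓘(ℝ, ℝ) h ((extChartAt I x).symm y)).comp
        (mfderivWithin 𝓘(ℝ, E) I (extChartAt I x).symm (Set.range I) y) :=
    mfderiv_comp_mfderivWithin y hh hs (I.uniqueMDiffOn y hyr)
  have h2 : ∀ v, (mfderivWithin 𝓘(ℝ, E) I (extChartAt I x).symm (Set.range I) y)
      ((mfderivWithin 𝓘(ℝ, E) I (extChartAt I x).symm (Set.range I) y).inverse v) = v :=
    (isInvertible_mfderivWithin_extChartAt_symm hy).self_apply_inverse
  rw [← mfderivWithin_eq_fderivWithin, h1]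
  change mvfderiv I h ((extChartAt I x).symm y) _ = _
  exact congrArg _ (h2 _)

/-- The Lie derivative along the bracket of two vector fields is the commutator of the Lie
derivatives. -/
theorem mvfderiv_mlieBracket [CompleteSpace E] [IsManifold I 2 M]
    {V W : Π y : M, TangentSpace I y} {f : M → ℝ} {x : M}
    (hV : MDifferentiableAt I I.tangent (fun y => (⟨y, V y⟩ : TangentBundle I M)) x)
    (hW : MDifferentiableAt I I.tangent (fun y => (⟨y, W y⟩ : TangentBundle I M)) x)
    (hf : ContMDiff I 𝓘(ℝ, ℝ) 2 f)
    (hVf : MDifferentiableAt I 𝓘(ℝ, ℝ) (fun y => mvfderiv I f y (V y)) x)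
    (hWf : MDifferentiableAt I 𝓘(ℝ, ℝ) (fun y => mvfderiv I f y (W y)) x) :
    mvfderiv I f x (mlieBracket I V W x) =
      mvfderiv I (fun y => mvfderiv I f y (W y)) x (V x) -
        mvfderiv I (fun y => mvfderiv I f y (V y)) x (W x) := by
  have : IsManifold I 1 M := IsManifold.of_le (n := 2) (by norm_num)
  have hx : extChartAt I x x ∈ (extChartAt I x).target := mem_extChartAt_target x
  have hxr : extChartAt I x x ∈ Set.range I := extChartAt_target_subset_range x hx
  have e : (extChartAt I x).symm (extChartAt I x x) = x := extChartAt_to_inv x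
  have hfd : ∀ z, MDifferentiableAt I 𝓘(ℝ, ℝ) f z := hf.mdifferentiable (by norm_num)
  have key : ∀ (Z : Π y : M, TangentSpace I y) (h : M → ℝ), MDifferentiableAt I 𝓘(ℝ, ℝ) h x →
      fderivWithin ℝ (h ∘ (extChartAt I x).symm) (Set.range I) (extChartAt I x x)
        (mpullbackWithin 𝓘(ℝ, E) I (extChartAt I x).symm Z (Set.range I) (extChartAt I x x)) =
      mvfderiv I h x (Z x) := fun Z h hh => by
    rw [fderivWithin_extChartAt_symm_mpullbackWithin hx (by rwa [e]), e]
  -- The derivative of `f` along `Z` is differentiated once more below, so its chart expression is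
  -- needed on a neighbourhood within the range of `I`, not only at the base point.
  have hloc : ∀ Z : Π y : M, TangentSpace I y,
      (fun y => fderivWithin ℝ (f ∘ (extChartAt I x).symm) (Set.range I) y
        (mpullbackWithin 𝓘(ℝ, E) I (extChartAt I x).symm Z (Set.range I) y))
      =ᶠ[nhdsWithin (extChartAt I x x) (Set.range I)]
      (fun y => mvfderiv I f y (Z y)) ∘ (extChartAt I x).symm := fun Z => by
    filter_upwards [extChartAt_target_mem_nhdsWithin x] with y hy
    exact fderivWithin_extChartAt_symm_mpullbackWithin hy (hfd _)
  have hF : ContDiffWithinAt ℝ 2 (f ∘ (extChartAt I x).symm) (Set.range I) (extChartAt I x x) := by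
    rw [← contMDiffWithinAt_iff_contDiffWithinAt]
    exact hf.contMDiffAt.comp_contMDiffWithinAt _
      (contMDiffWithinAt_extChartAt_symm_range (n := 2) x hx)
  have hd : ∀ {Z : Π y : M, TangentSpace I y},
      MDifferentiableAt I I.tangent (fun y => (⟨y, Z y⟩ : TangentBundle I M)) x →
      DifferentiableWithinAt ℝ
        (mpullbackWithin 𝓘(ℝ, E) I (extChartAt I x).symm Z (Set.range I)) (Set.range I)
        (extChartAt I x x) := fun hZ => by
    have := (mdifferentiableWithinAt_univ.2 hZ).differentiableWithinAt_mpullbackWithin_vectorField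
    rwa [Set.preimage_univ, Set.univ_inter] at this
  -- The second-order terms cancel by symmetry of the second derivative of the `C²` function `f` in
  -- the chart. At a boundary point this symmetry uses that the point lies in the closure of the
  -- interior of the range.
  have hbr := fderivWithin_apply_lieBracket hF (by simp) I.uniqueDiffOn
    (I.range_subset_closure_interior hxr) hxr (hd hW) (hd hV)
  rw [(hloc W).fderivWithin_eq_of_mem hxr, (hloc V).fderivWithin_eq_of_mem hxr,
    key V _ hWf, key W _ hVf] at hbr
  -- `mlieBracket` carries the bracket in the chart back by the inverse of the differential of the
  -- chart; this is the differential of the inverse chart, to which the chain rule applies.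
  have hinv : (mfderiv I 𝓘(ℝ, E) (extChartAt I x) x).inverse =
      mfderivWithin 𝓘(ℝ, E) I (extChartAt I x).symm (Set.range I) (extChartAt I x x) :=
    ContinuousLinearMap.inverse_eq
      (mfderiv_extChartAt_comp_mfderivWithin_extChartAt_symm' (mem_extChartAt_source x))
      (mfderivWithin_extChartAt_symm_comp_mfderiv_extChartAt' (mem_extChartAt_source x))
  have h1 : mfderivWithin 𝓘(ℝ, E) 𝓘(ℝ, ℝ) (f ∘ (extChartAt I x).symm) (Set.range I)
      (extChartAt I x x) = (mfderiv I 𝓘(ℝ, ℝ) f x).comp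
        (mfderivWithin 𝓘(ℝ, E) I (extChartAt I x).symm (Set.range I) (extChartAt I x x)) :=
    mfderiv_comp_mfderivWithin_of_eq (hfd x) (mdifferentiableWithinAt_extChartAt_symm hx)
      (I.uniqueMDiffOn _ hxr) e
  rw [← hbr, ← mlieBracketWithin_univ, mlieBracketWithin_apply, Set.preimage_univ, Set.univ_inter,
    hinv, ← mfderivWithin_eq_fderivWithin, h1]
  rfl

end Commutator

/-! ### Generalities on manifolds and Lie groups -/

/-- A differentiable map with vanishing derivative on a connected manifold is constant. -/
theorem eq_of_mfderiv_eq_zero {E H M E' H' N : Type*} [NormedAddCommGroup E] [NormedSpace ℝ E]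
    [TopologicalSpace H] {I : ModelWithCorners ℝ E H} [I.Boundaryless] [TopologicalSpace M]
    [ChartedSpace H M] [IsManifold I 1 M] [ConnectedSpace M] [NormedAddCommGroup E']
    [NormedSpace ℝ E'] [TopologicalSpace H'] {I' : ModelWithCorners ℝ E' H'} [TopologicalSpace N]
    [ChartedSpace H' N] [IsManifold I' 1 N] {F : M → N} (hF : MDifferentiable I I' F)
    (h0 : ∀ x, mfderiv I I' F x = 0) (a b : M) : F a = F b := by
  have hlc : IsLocallyConstant F := by
    rw [IsLocallyConstant.iff_eventually_eq]
    intro x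
    have hx : extChartAt I x x ∈ (extChartAt I x).target := mem_extChartAt_target x
    have hsymm : ContinuousAt (extChartAt I x).symm (extChartAt I x x) :=
      continuousAt_extChartAt_symm x
    have e : (extChartAt I x).symm (extChartAt I x x) = x := extChartAt_to_inv x
    have hcont : ContinuousAt (F ∘ (extChartAt I x).symm) (extChartAt I x x) :=
      ContinuousAt.comp (by rw [e]; exact (hF x).continuousAt) hsymm
    -- Continuity keeps the values of `F` in a single chart of `N`, so that on a small ball the
    -- statement becomes one about maps between normed spaces.
    have hsrc : ∀ᶠ y in nhds (extChartAt I x x),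
        F ((extChartAt I x).symm y) ∈ (extChartAt I' (F x)).source := by
      apply hcont
      simp only [Function.comp_apply, e]
      exact extChartAt_source_mem_nhds (F x)
    obtain ⟨r, hr, hball⟩ := Metric.mem_nhds_iff.1
      (Filter.inter_mem (extChartAt_target_mem_nhds (I := I) x) hsrc)
    have hder : ∀ y ∈ Metric.ball (extChartAt I x x) r,
        HasFDerivAt (extChartAt I' (F x) ∘ F ∘ (extChartAt I x).symm) (0 : E →L[ℝ] E') y := by
      intro y hy
      obtain ⟨hyt, hys⟩ := hball hy
      have hs := mdifferentiableWithinAt_extChartAt_symm (I := I) hyt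
      rw [I.range_eq_univ, mdifferentiableWithinAt_univ] at hs
      have h1 : HasMFDerivAt I I' F ((extChartAt I x).symm y) 0 := by
        rw [← h0]; exact (hF _).hasMFDerivAt
      have h2 : HasMFDerivAt I' 𝓘(ℝ, E') (extChartAt I' (F x)) (F ((extChartAt I x).symm y))
          (mfderiv I' 𝓘(ℝ, E') (extChartAt I' (F x)) (F ((extChartAt I x).symm y))) :=
        (mdifferentiableAt_extChartAt (by simpa using hys)).hasMFDerivAt
      have h3 := h2.comp y (h1.comp y hs.hasMFDerivAt)
      rw [ContinuousLinearMap.zero_comp, ContinuousLinearMap.comp_zero] at h3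
      exact h3.hasFDerivAt
    have hconst : ∀ y ∈ Metric.ball (extChartAt I x x) r,
        (extChartAt I' (F x) ∘ F ∘ (extChartAt I x).symm) y =
          (extChartAt I' (F x) ∘ F ∘ (extChartAt I x).symm) (extChartAt I x x) := fun y hy =>
      (convex_ball _ r).is_const_of_fderivWithin_eq_zero (𝕜 := ℝ)
        (fun z hz => (hder z hz).differentiableAt.differentiableWithinAt)
        (fun z hz => by
          rw [fderivWithin_of_isOpen Metric.isOpen_ball hz]; exact (hder z hz).fderiv)
        hy (Metric.mem_ball_self hr)
    filter_upwards [extChartAt_source_mem_nhds (I := I) x,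
      continuousAt_extChartAt (I := I) x (Metric.ball_mem_nhds _ hr)] with z hz hzb
    have h4 := hconst _ hzb
    have h5 := (hball hzb).2
    simp only [Set.mem_ofPred_eq, Function.comp_apply, (extChartAt I x).left_inv hz, e] at h4 h5
    exact (extChartAt I' (F x)).injOn h5 (mem_extChartAt_source (F x)) h4
  exact hlc.apply_eq_of_isPreconnected isPreconnected_univ trivial trivial

/-- Left-invariant vector fields on a smooth Lie group are smooth. -/
theorem contMDiff_infty_mulInvariantVectorField {E H G : Type*} [NormedAddCommGroup E]
    [NormedSpace ℝ E] [TopologicalSpace H] {I : ModelWithCorners ℝ E H} [TopologicalSpace G]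
    [ChartedSpace H G] [Group G] [LieGroup I ∞ G] (v : GroupLieAlgebra I G) :
    ContMDiff I I.tangent ∞
      (fun g => (⟨g, mulInvariantVectorField v g⟩ : TangentBundle I G)) := by
  -- The differential of the multiplication at `(g, 1)` sends `(0, v)` to `dL_g v`. The field is
  -- therefore the tangent map of the multiplication composed with the zero section and a constant.
  have s0 : ContMDiff I I.tangent ∞ (fun g : G => (⟨g, 0⟩ : TangentBundle I G)) :=
    Bundle.contMDiff_zeroSection _ _
  have s1 : ContMDiff I I.tangent ∞ (fun _ : G => (⟨1, v⟩ : TangentBundle I G)) :=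
    contMDiff_const
  have s2 : ContMDiff (I.prod I).tangent I.tangent ∞
      (tangentMap (I.prod I) I (fun p : G × G => p.1 * p.2)) :=
    (contMDiff_mul I ∞).contMDiff_tangentMap (by simp)
  have s3 := (s2.comp contMDiff_equivTangentBundleProd_symm).comp (s0.prodMk s1)
  convert! s3 with g
  · simp
  · simp only [Function.comp_apply, tangentMap]
    rw [mfderiv_prod_eq_add_apply ((contMDiff_mul I ∞).mdifferentiableAt (by simp))]
    exact ((congrArg₂ (· + ·) (map_zero _) rfl).trans (zero_add _)).symm

/-- The differential of a smooth map with a smooth inverse is bijective. -/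
theorem mfderiv_bijective_of_inverse {E H M E' H' N : Type*} [NormedAddCommGroup E]
    [NormedSpace ℝ E] [TopologicalSpace H] {I : ModelWithCorners ℝ E H} [TopologicalSpace M]
    [ChartedSpace H M] [NormedAddCommGroup E'] [NormedSpace ℝ E'] [TopologicalSpace H']
    {I' : ModelWithCorners ℝ E' H'} [TopologicalSpace N] [ChartedSpace H' N] {f : M → N}
    {f' : N → M} (hf : ContMDiff I I' ∞ f) (hf' : ContMDiff I' I ∞ f')
    (hl : Function.LeftInverse f' f) (hr : Function.RightInverse f' f) (x : M) :
    Function.Bijective (mfderiv I I' f x) :=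
  ((Diffeomorph.mk ⟨f, f', hl, hr⟩ hf hf' : Diffeomorph I I' M N ∞).mfderivToContinuousLinearEquiv
    (by simp) x).bijective

/-! ### The multiplication map `G × G* → D` and the dressing fields -/

namespace DoubleGroup

variable {n : ℕ} {G Gs D : Type*}
  [TopologicalSpace G] [ChartedSpace (EuclideanSpace ℝ (Fin n)) G] [Group G] [LieGroup (𝓡 n) ∞ G]
  [TopologicalSpace Gs] [ChartedSpace (EuclideanSpace ℝ (Fin n)) Gs] [Group Gs]
  [LieGroup (𝓡 n) ∞ Gs]
  [TopologicalSpace D] [ChartedSpace (EuclideanSpace ℝ (Fin (2 * n))) D] [Group D]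
  [LieGroup (𝓡 (2 * n)) ∞ D] (B : DoubleGroup n G Gs D)

/-- The inclusion `𝔤 → 𝔡`. -/
def lieInl (X : GroupLieAlgebra (𝓡 n) G) : GroupLieAlgebra (𝓡 (2 * n)) D :=
  mfderiv (𝓡 n) (𝓡 (2 * n)) B.inl 1 X

/-- The inclusion `𝔤* → 𝔡`. -/
def lieInr (ξ : GroupLieAlgebra (𝓡 n) Gs) : GroupLieAlgebra (𝓡 (2 * n)) D :=
  mfderiv (𝓡 n) (𝓡 (2 * n)) B.inr 1 ξ

theorem doubleEquiv_lieInl (X : GroupLieAlgebra (𝓡 n) G) :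
    B.doubleEquiv (B.lieInl X) = (X, 0) := B.inl_deriv X

theorem doubleEquiv_lieInr (ξ : GroupLieAlgebra (𝓡 n) Gs) :
    B.doubleEquiv (B.lieInr ξ) = (0, B.dualEquiv ξ) := B.inr_deriv ξ

theorem doubleEquiv_lieInl_add_lieInr (X : GroupLieAlgebra (𝓡 n) G)
    (ξ : GroupLieAlgebra (𝓡 n) Gs) :
    B.doubleEquiv (B.lieInl X + B.lieInr ξ) = (X, B.dualEquiv ξ) := by
  rw [map_add, doubleEquiv_lieInl, doubleEquiv_lieInr, Prod.mk_add_mk, add_zero, zero_add]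

theorem lieInl_lie (X Y : GroupLieAlgebra (𝓡 n) G) :
    B.lieInl ⁅X, Y⁆ = ⁅B.lieInl X, B.lieInl Y⁆ := by
  apply B.doubleEquiv.injective
  rw [B.doubleEquiv_lie, doubleEquiv_lieInl, doubleEquiv_lieInl, doubleEquiv_lieInl]
  ext <;> simp [doubleBracket, dualCoadjoint, dualBracket, coadjoint, tensorPairing]

/-- The multiplication map `(g, u) ↦ g u` from `G × G*` to the double. -/
def mulMap (p : G × Gs) : D := B.inl p.1 * B.inr p.2

theorem contMDiff_mulMap : ContMDiff ((𝓡 n).prod (𝓡 n)) (𝓡 (2 * n)) ∞ B.mulMap :=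
  (B.inl_smooth.comp contMDiff_fst).mul (B.inr_smooth.comp contMDiff_snd)

theorem mfderiv_mulMap_one (X : GroupLieAlgebra (𝓡 n) G) (ξ : GroupLieAlgebra (𝓡 n) Gs) :
    mfderiv ((𝓡 n).prod (𝓡 n)) (𝓡 (2 * n)) B.mulMap (1, 1) (X, ξ) =
      B.lieInl X + B.lieInr ξ := by
  have h0 := fun v => mfderiv_prod_eq_add_apply (p := ((1, 1) : G × Gs)) (v := v)
    (B.contMDiff_mulMap.mdifferentiableAt (by simp))
  refine (h0 _).trans ?_
  have h1 : (fun z : G => B.mulMap (z, 1)) = B.inl := by ext z; simp [mulMap]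
  have h2 : (fun z : Gs => B.mulMap (1, z)) = B.inr := by ext z; simp [mulMap]
  -- The summands lie in tangent spaces at base points that agree only propositionally; they are
  -- compared in the common model space.
  let V := EuclideanSpace ℝ (Fin (2 * n))
  have h3 : (mfderiv (𝓡 n) (𝓡 (2 * n)) (fun z : G => B.mulMap (z, 1)) 1 X : V) = B.lieInl X :=
    congrArg (fun a : G → D => (mfderiv (𝓡 n) (𝓡 (2 * n)) a 1 X : V)) h1
  have h4 : (mfderiv (𝓡 n) (𝓡 (2 * n)) (fun z : Gs => B.mulMap (1, z)) 1 ξ : V) = B.lieInr ξ :=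
    congrArg (fun a : Gs → D => (mfderiv (𝓡 n) (𝓡 (2 * n)) a 1 ξ : V)) h2
  exact congrArg₂ (fun a b : V => a + b) h3 h4

/-- The map `d ↦ g d u` of the double. -/
def mulLeftRight (g : G) (u : Gs) (d : D) : D := B.inl g * d * B.inr u

theorem contMDiff_mulLeftRight (g : G) (u : Gs) :
    ContMDiff (𝓡 (2 * n)) (𝓡 (2 * n)) ∞ (B.mulLeftRight g u) :=
  (contMDiff_const.mul contMDiff_id).mul contMDiff_const

/-- Since `(g h)(v u) = g (h v) u`, left translation in `G` and right translation in `G*` carry the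
multiplication map at the unit to the multiplication map at `(g, u)`. This reduces every statement
about its differential to the splitting `𝔡 = 𝔤 ⊕ 𝔤*`. -/
theorem mfderiv_mulMap_translate (g : G) (u : Gs) (X : GroupLieAlgebra (𝓡 n) G)
    (ξ : GroupLieAlgebra (𝓡 n) Gs) :
    mfderiv ((𝓡 n).prod (𝓡 n)) (𝓡 (2 * n)) B.mulMap (g, u)
        (mfderiv (𝓡 n) (𝓡 n) (fun h => g * h) 1 X, mfderiv (𝓡 n) (𝓡 n) (fun v => v * u) 1 ξ) =
      mfderiv (𝓡 (2 * n)) (𝓡 (2 * n)) (B.mulLeftRight g u) 1 (B.lieInl X + B.lieInr ξ) := by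
  have hl : MDifferentiableAt (𝓡 n) (𝓡 n) (fun h : G => g * h) 1 :=
    contMDiff_mul_left.mdifferentiableAt (n := ∞) (by simp)
  have hr : MDifferentiableAt (𝓡 n) (𝓡 n) (fun v : Gs => v * u) 1 :=
    contMDiff_mul_right.mdifferentiableAt (n := ∞) (by simp)
  have e : B.mulMap ∘ Prod.map (fun h => g * h) (fun v => v * u) =
      B.mulLeftRight g u ∘ B.mulMap := by
    ext p; simp [mulMap, mulLeftRight, mul_assoc]
  have h1 := mfderiv_comp_apply_of_eq (x := ((1, 1) : G × Gs)) (y := (g, u))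
    (B.contMDiff_mulMap.mdifferentiableAt (by simp))
    (hl.prodMap hr) (by simp) (X, ξ)
  have h2 := mfderiv_comp_apply_of_eq (x := ((1, 1) : G × Gs)) (y := 1)
    ((B.contMDiff_mulLeftRight g u).mdifferentiableAt (by simp))
    (B.contMDiff_mulMap.mdifferentiableAt (by simp)) (by simp [mulMap]) (X, ξ)
  rw [e, mfderiv_prodMap hl hr] at h1
  rw [B.mfderiv_mulMap_one] at h2
  exact h1.symm.trans h2

theorem bijective_mfderiv_mulMap (p : G × Gs) :
    Function.Bijective (mfderiv ((𝓡 n).prod (𝓡 n)) (𝓡 (2 * n)) B.mulMap p) := by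
  obtain ⟨g, u⟩ := p
  have hl : Function.Bijective (mfderiv (𝓡 n) (𝓡 n) (fun h : G => g * h) 1) :=
    mfderiv_bijective_of_inverse (f' := fun h => g⁻¹ * h) contMDiff_mul_left contMDiff_mul_left
      (fun h => by simp) (fun h => by simp) 1
  have hr : Function.Bijective (mfderiv (𝓡 n) (𝓡 n) (fun v : Gs => v * u) 1) :=
    mfderiv_bijective_of_inverse (f' := fun v => v * u⁻¹) contMDiff_mul_right contMDiff_mul_right
      (fun h => by simp) (fun h => by simp) 1
  have hc : Function.Bijective (mfderiv (𝓡 (2 * n)) (𝓡 (2 * n)) (B.mulLeftRight g u) 1) :=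
    mfderiv_bijective_of_inverse (f' := B.mulLeftRight g⁻¹ u⁻¹) (B.contMDiff_mulLeftRight _ _)
      (B.contMDiff_mulLeftRight _ _) (fun h => by simp [mulLeftRight, mul_assoc])
      (fun h => by simp [mulLeftRight, mul_assoc]) 1
  constructor
  · rw [injective_iff_map_eq_zero]
    rintro ⟨v, w⟩ h0
    obtain ⟨X, rfl⟩ := hl.2 v
    obtain ⟨ξ, rfl⟩ := hr.2 w
    have h1 := hc.1 (((B.mfderiv_mulMap_translate g u X ξ).symm.trans h0).trans (map_zero _).symm)
    have h2 := B.doubleEquiv_lieInl_add_lieInr X ξ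
    rw [h1, map_zero] at h2
    obtain ⟨h3, h4⟩ := Prod.ext_iff.1 h2
    have h5 : ξ = 0 := B.dualEquiv.injective (by rw [map_zero]; exact h4.symm)
    have h6 : X = 0 := h3.symm
    rw [h5, h6, map_zero, map_zero]
    rfl
  · intro z
    -- The preimage is found by translating back to the unit, splitting there into `𝔤` and `𝔤*`
    -- parts, and translating each part forward.
    obtain ⟨y, rfl⟩ := hc.2 z
    refine ⟨(mfderiv (𝓡 n) (𝓡 n) (fun h => g * h) 1 (B.doubleEquiv y).1,
      mfderiv (𝓡 n) (𝓡 n) (fun v => v * u) 1 (B.dualEquiv.symm (B.doubleEquiv y).2)), ?_⟩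
    have h1 : B.lieInl (B.doubleEquiv y).1 + B.lieInr (B.dualEquiv.symm (B.doubleEquiv y).2) = y :=
      B.doubleEquiv.injective (by rw [doubleEquiv_lieInl_add_lieInr]; simp)
    have h2 := B.mfderiv_mulMap_translate g u (B.doubleEquiv y).1
      (B.dualEquiv.symm (B.doubleEquiv y).2)
    rw [h1] at h2
    exact h2

theorem isInvertible_mfderiv_mulMap (p : G × Gs) :
    (mfderiv ((𝓡 n).prod (𝓡 n)) (𝓡 (2 * n)) B.mulMap p).IsInvertible := by
  let L : EuclideanSpace ℝ (Fin n) × EuclideanSpace ℝ (Fin n) →L[ℝ] EuclideanSpace ℝ (Fin (2 * n)) :=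
    mfderiv ((𝓡 n).prod (𝓡 n)) (𝓡 (2 * n)) B.mulMap p
  exact ⟨ContinuousLinearEquiv.ofBijective L (LinearMap.ker_eq_bot.2 (B.bijective_mfderiv_mulMap p).1)
    (LinearMap.range_eq_top.2 (B.bijective_mfderiv_mulMap p).2), rfl⟩

/-- The left-invariant vector field of `X ∈ 𝔤` on the double is tangent, in the coordinates given
by the multiplication map, to a field whose `G*`-component is the dressing field. -/
theorem exists_mfderiv_mulMap_dressingField (X : GroupLieAlgebra (𝓡 n) G) (g : G) (u : Gs) :
    ∃ v : TangentSpace (𝓡 n) g,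
      mfderiv ((𝓡 n).prod (𝓡 n)) (𝓡 (2 * n)) B.mulMap (g, u) (v, B.dressingField X u) =
        mulInvariantVectorField (B.lieInl X) (B.mulMap (g, u)) := by
  have hconj : ContMDiff (𝓡 (2 * n)) (𝓡 (2 * n)) ∞ (fun d : D => B.inr u * d * (B.inr u)⁻¹) :=
    (contMDiff_const.mul contMDiff_id).mul contMDiff_const
  let y : GroupLieAlgebra (𝓡 (2 * n)) D :=
    mfderiv (𝓡 (2 * n)) (𝓡 (2 * n)) (fun d : D => B.inr u * d * (B.inr u)⁻¹) 1 (B.lieInl X)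
  have h1 : B.lieInl (B.doubleEquiv y).1 + B.lieInr (B.dualEquiv.symm (B.doubleEquiv y).2) = y :=
    B.doubleEquiv.injective (by rw [doubleEquiv_lieInl_add_lieInr]; simp)
  have h2 := B.mfderiv_mulMap_translate g u (B.doubleEquiv y).1
    (B.dualEquiv.symm (B.doubleEquiv y).2)
  rw [h1] at h2
  refine ⟨mfderiv (𝓡 n) (𝓡 n) (fun h => g * h) 1 (B.doubleEquiv y).1, h2.trans ?_⟩
  -- The identity `g (u d u⁻¹) u = (g u) d` turns `Ad_u X`, moved to `g u`, into the left-invariant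
  -- field of `X`.
  have e : B.mulLeftRight g u ∘ (fun d : D => B.inr u * d * (B.inr u)⁻¹) =
      fun d => B.mulMap (g, u) * d := by
    ext d; simp [mulMap, mulLeftRight, mul_assoc]
  have h3 := mfderiv_comp_apply_of_eq (x := (1 : D)) (y := 1)
    ((B.contMDiff_mulLeftRight g u).mdifferentiableAt (by simp))
    (hconj.mdifferentiableAt (by simp)) (by simp) (B.lieInl X)
  rw [e] at h3
  exact h3.symm

/-- Injectivity of the differential makes this a characterization of the dressing field; it
identifies both the lifted field and the velocity of a global dressing action. -/
theorem eq_dressingField_of_mfderiv_mulMap {X : GroupLieAlgebra (𝓡 n) G} {g : G} {u : Gs}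
    {v : TangentSpace (𝓡 n) g} {w : TangentSpace (𝓡 n) u}
    (h : mfderiv ((𝓡 n).prod (𝓡 n)) (𝓡 (2 * n)) B.mulMap (g, u) (v, w) =
      mulInvariantVectorField (B.lieInl X) (B.mulMap (g, u))) : w = B.dressingField X u := by
  obtain ⟨v', hv'⟩ := B.exists_mfderiv_mulMap_dressingField X g u
  exact (Prod.ext_iff.1 ((B.bijective_mfderiv_mulMap (g, u)).1 (h.trans hv'.symm))).2

/-- The left-invariant vector field of `X ∈ 𝔤` on the double, pulled back to `G × G*` along the
multiplication map. -/
def liftField (X : GroupLieAlgebra (𝓡 n) G) (p : G × Gs) :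
    TangentSpace ((𝓡 n).prod (𝓡 n)) p :=
  mpullback ((𝓡 n).prod (𝓡 n)) (𝓡 (2 * n)) B.mulMap (mulInvariantVectorField (B.lieInl X)) p

theorem mfderiv_mulMap_liftField (X : GroupLieAlgebra (𝓡 n) G) (p : G × Gs) :
    mfderiv ((𝓡 n).prod (𝓡 n)) (𝓡 (2 * n)) B.mulMap p (B.liftField X p) =
      mulInvariantVectorField (B.lieInl X) (B.mulMap p) :=
  (B.isInvertible_mfderiv_mulMap p).self_apply_inverse _

theorem liftField_snd (X : GroupLieAlgebra (𝓡 n) G) (p : G × Gs) :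
    (B.liftField X p).2 = B.dressingField X p.2 :=
  B.eq_dressingField_of_mfderiv_mulMap (B.mfderiv_mulMap_liftField X p)

theorem liftField_add (X Y : GroupLieAlgebra (𝓡 n) G) (p : G × Gs) :
    B.liftField (X + Y) p = B.liftField X p + B.liftField Y p := by
  have h : B.lieInl (X + Y) = B.lieInl X + B.lieInl Y := map_add _ X Y
  rw [liftField, h, mulInvariantVectorField_add, mpullback_add_apply]
  rfl

theorem liftField_smul (c : ℝ) (X : GroupLieAlgebra (𝓡 n) G) (p : G × Gs) :
    B.liftField (c • X) p = c • B.liftField X p := by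
  have h : B.lieInl (c • X) = c • B.lieInl X := map_smul _ c X
  rw [liftField, h, mulInvariantVectorField_smul, mpullback_const_smul_apply]
  rfl

theorem contMDiff_liftField (X : GroupLieAlgebra (𝓡 n) G) :
    ContMDiff ((𝓡 n).prod (𝓡 n)) ((𝓡 n).prod (𝓡 n)).tangent ∞
      (fun p => (⟨p, B.liftField X p⟩ : TangentBundle ((𝓡 n).prod (𝓡 n)) (G × Gs))) :=
  (contMDiff_infty_mulInvariantVectorField (B.lieInl X)).mpullback_vectorField B.contMDiff_mulMap
    B.isInvertible_mfderiv_mulMap (by simp)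

/-- Pullback along a local diffeomorphism commutes with brackets, and on left-invariant fields the
bracket is that of `𝔡`, in which `𝔤` is a subalgebra. -/
theorem liftField_lie (X Y : GroupLieAlgebra (𝓡 n) G) :
    B.liftField ⁅X, Y⁆ = mlieBracket ((𝓡 n).prod (𝓡 n)) (B.liftField X) (B.liftField Y) := by
  ext1 p
  have h := mpullback_mlieBracket (n := ∞) (x₀ := p) (I := (𝓡 n).prod (𝓡 n))
    (mdifferentiableAt_mulInvariantVectorField (B.lieInl X))
    (mdifferentiableAt_mulInvariantVectorField (B.lieInl Y))
    B.contMDiff_mulMap.contMDiffAt (by simpa using by norm_cast)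
  rw [← mulInvariantVector_mlieBracket] at h
  refine Eq.trans ?_ h
  rw [liftField, lieInl_lie, GroupLieAlgebra.bracket_def]

theorem smoothVectorField_dressingField (X : GroupLieAlgebra (𝓡 n) G) :
    SmoothVectorField (B.dressingField X) := by
  -- The dressing field is the lifted field restricted to the slice `{1} × G*` and projected to
  -- `G*`.
  have h1 : ContMDiff (𝓡 n) ((𝓡 n).prod (𝓡 n)) ∞ (fun u : Gs => ((1 : G), u)) :=
    contMDiff_const.prodMk contMDiff_id
  have h2 : ContMDiff ((𝓡 n).prod (𝓡 n)).tangent (𝓡 n).tangent ∞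
      (tangentMap ((𝓡 n).prod (𝓡 n)) (𝓡 n) (Prod.snd : G × Gs → Gs)) :=
    contMDiff_snd.contMDiff_tangentMap (n := ∞) (by simp)
  refine (h2.comp ((B.contMDiff_liftField X).comp h1)).congr fun u => ?_
  simp only [Function.comp_apply, tangentMap_prodSnd]
  rw [liftField_snd]

/-- On functions pulled back from `G*`, the lifted field acts as the dressing field. -/
theorem mvfderiv_comp_snd_liftField (X : GroupLieAlgebra (𝓡 n) G) {f : Gs → ℝ} {p : G × Gs}
    (hf : MDifferentiableAt (𝓡 n) 𝓘(ℝ, ℝ) f p.2) :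
    mvfderiv ((𝓡 n).prod (𝓡 n)) (f ∘ Prod.snd) p (B.liftField X p) =
      lieDeriv (B.dressingField X) f p.2 := by
  rw [mvfderiv_comp_apply _ hf mdifferentiableAt_snd, mfderiv_snd, lieDeriv, ← liftField_snd]
  rfl

/-- The infinitesimal dressing action of `𝔤` on `G*`. -/
def dressingAction : InfinitesimalAction (GroupLieAlgebra (𝓡 n) G) n Gs where
  field :=
    { toFun := B.dressingField
      map_add' := fun X Y => by
        ext1 u
        have h := congrArg Prod.snd (B.liftField_add X Y (1, u))
        rw [liftField_snd] at h
        exact h.trans (congrArg₂ (fun a b : EuclideanSpace ℝ (Fin n) => a + b)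
          (B.liftField_snd X (1, u)) (B.liftField_snd Y (1, u)))
      map_smul' := fun c X => by
        ext1 u
        have h := congrArg Prod.snd (B.liftField_smul c X (1, u))
        rw [liftField_snd] at h
        exact h.trans (congrArg (fun a : EuclideanSpace ℝ (Fin n) => c • a)
          (B.liftField_snd X (1, u))) }
  smooth := B.smoothVectorField_dressingField
  lie X Y f := by
    ext1 u
    have hd : ∀ (h : C^∞⟮𝓡 n, Gs; ℝ⟯) (v : Gs), MDifferentiableAt (𝓡 n) 𝓘(ℝ, ℝ) h v := fun h v =>
      h.contMDiff.mdifferentiableAt (by simp)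
    let ℓ : GroupLieAlgebra (𝓡 n) G → C^∞⟮𝓡 n, Gs; ℝ⟯ := fun Z =>
      ⟨lieDeriv (B.dressingField Z) f,
        (B.smoothVectorField_dressingField Z).contMDiff_lieDeriv f⟩
    have e : ∀ Z, (fun p : G × Gs => mvfderiv ((𝓡 n).prod (𝓡 n)) (f ∘ Prod.snd) p
        (B.liftField Z p)) = ℓ Z ∘ Prod.snd := fun Z => by
      ext1 p
      exact B.mvfderiv_comp_snd_liftField Z (hd f p.2)
    have hs : ∀ Z, MDifferentiableAt ((𝓡 n).prod (𝓡 n)) 𝓘(ℝ, ℝ) (fun p : G × Gs =>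
        mvfderiv ((𝓡 n).prod (𝓡 n)) (f ∘ Prod.snd) p (B.liftField Z p)) (1, u) := fun Z => by
      rw [e]
      exact (hd _ _).comp _ mdifferentiableAt_snd
    -- The commutator formula is applied upstairs to functions constant along `G`. The lifted fields
    -- preserve these functions and act on them as the dressing fields, so the relation descends to
    -- `G*`.
    have h := mvfderiv_mlieBracket (f := f ∘ (Prod.snd : G × Gs → Gs)) (x := ((1 : G), u))
      ((B.contMDiff_liftField X).mdifferentiableAt (by simp))
      ((B.contMDiff_liftField Y).mdifferentiableAt (by simp))
      ((f.contMDiff.comp contMDiff_snd).of_le (by norm_cast)) (hs X) (hs Y)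
    rw [← liftField_lie, e, e, B.mvfderiv_comp_snd_liftField _ (hd f u),
      B.mvfderiv_comp_snd_liftField _ (hd _ u), B.mvfderiv_comp_snd_liftField _ (hd _ u)] at h
    exact h

end DoubleGroup

/-! ### Intertwining of actions of the enveloping algebra -/

/-- The induction principle of the universal enveloping algebra. -/
theorem UniversalEnvelopingAlgebra.induction_on_generators {R L : Type*} [CommRing R] [LieRing L]
    [LieAlgebra R L] {p : UniversalEnvelopingAlgebra R L → Prop}
    (algebraMap : ∀ r, p (algebraMap R _ r)) (ι : ∀ x, p (UniversalEnvelopingAlgebra.ι R x))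
    (mul : ∀ a b, p a → p b → p (a * b)) (add : ∀ a b, p a → p b → p (a + b))
    (a : UniversalEnvelopingAlgebra R L) : p a := by
  have hsurj : Function.Surjective (UniversalEnvelopingAlgebra.mkAlgHom R L) :=
    RingCon.mk'_surjective _
  obtain ⟨t, rfl⟩ := hsurj a
  induction t using TensorAlgebra.induction with
  | algebraMap r => rw [AlgHom.commutes]; exact algebraMap r
  | ι x => exact ι x
  | mul a b ha hb => rw [map_mul]; exact mul _ _ ha hb
  | add a b ha hb => rw [map_add]; exact add _ _ ha hb

section

variable {m k : ℕ} {M N : Type*} [TopologicalSpace M] [ChartedSpace (EuclideanSpace ℝ (Fin m)) M]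
  [IsManifold (𝓡 m) ∞ M] [TopologicalSpace N] [ChartedSpace (EuclideanSpace ℝ (Fin k)) N]
  [IsManifold (𝓡 k) ∞ N] {L : Type*} [LieRing L] [LieAlgebra ℝ L]

theorem InfinitesimalAction.hopfAction_ι (φ : InfinitesimalAction L m M) (X : L)
    (f : C^∞⟮𝓡 m, M; ℝ⟯) :
    (φ.hopfAction (UniversalEnvelopingAlgebra.ι ℝ X) f : M → ℝ) = lieDeriv (φ.field X) f := by
  rw [hopfAction, UniversalEnvelopingAlgebra.lift_ι_apply]
  rfl

/-- The pullback along a map intertwining two infinitesimal actions intertwines the Hopf algebra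
actions. -/
theorem InfinitesimalAction.hopfAction_pullbackHom (φ : InfinitesimalAction L m M)
    (ψ : InfinitesimalAction L k N) (J : C^∞⟮𝓡 m, M; 𝓡 k, N⟯)
    (h : ∀ X x, mfderiv (𝓡 m) (𝓡 k) J x (φ.field X x) = ψ.field X (J x))
    (a : UniversalEnvelopingAlgebra ℝ L) (f : C^∞⟮𝓡 k, N; ℝ⟯) :
    φ.hopfAction a (pullbackHom J f) = pullbackHom J (ψ.hopfAction a f) := by
  -- For a product `a * b` the hypothesis on `a` is applied to the image of `f` under `b`, so `f`
  -- must vary.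
  induction a using UniversalEnvelopingAlgebra.induction_on_generators generalizing f with
  | algebraMap r =>
    simp only [AlgHom.commutes, Module.algebraMap_end_apply, map_smul]
  | ι X =>
    ext x
    have h1 : pullbackHom J (ψ.hopfAction (UniversalEnvelopingAlgebra.ι ℝ X) f) x =
        ψ.hopfAction (UniversalEnvelopingAlgebra.ι ℝ X) f (J x) := rfl
    rw [h1, hopfAction_ι, hopfAction_ι, lieDeriv, lieDeriv, ← h]
    exact mvfderiv_comp_apply x (f.contMDiff.mdifferentiableAt (by simp))
      (J.contMDiff.mdifferentiableAt (by simp)) _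
  | mul a b ha hb => simp only [map_mul, Module.End.mul_apply, ha, hb]
  | add a b ha hb => simp only [map_add, LinearMap.add_apply, ha, hb]

end

/-! ### Global dressing actions and coactions -/

namespace DoubleGroup.GlobalDressing

variable {n : ℕ} {G Gs D : Type*}
  [TopologicalSpace G] [ChartedSpace (EuclideanSpace ℝ (Fin n)) G] [Group G] [LieGroup (𝓡 n) ∞ G]
  [TopologicalSpace Gs] [ChartedSpace (EuclideanSpace ℝ (Fin n)) Gs] [Group Gs]
  [LieGroup (𝓡 n) ∞ Gs]
  [TopologicalSpace D] [ChartedSpace (EuclideanSpace ℝ (Fin (2 * n))) D] [Group D]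
  [LieGroup (𝓡 (2 * n)) ∞ D] {B : DoubleGroup n G Gs D} (R : B.GlobalDressing)

theorem contMDiff_act_right (u : Gs) : ContMDiff (𝓡 n) (𝓡 n) ∞ (fun g : G => R.act (u, g)) :=
  R.act.contMDiff.comp (contMDiff_const.prodMk contMDiff_id)

theorem contMDiff_act_left (g : G) : ContMDiff (𝓡 n) (𝓡 n) ∞ (fun u : Gs => R.act (u, g)) :=
  R.act.contMDiff.comp (contMDiff_id.prodMk contMDiff_const)

/-- A global dressing action is generated by the infinitesimal dressing action. -/
theorem mfderiv_act (u : Gs) (X : GroupLieAlgebra (𝓡 n) G) :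
    mfderiv (𝓡 n) (𝓡 n) (fun g : G => R.act (u, g)) 1 X = B.dressingField X u := by
  obtain ⟨lam, hlam, hev⟩ := R.factorization u
  have hl : MDifferentiableAt (𝓡 n) (𝓡 n) lam 1 := hlam.mdifferentiableAt (by simp)
  have ha : MDifferentiableAt (𝓡 n) (𝓡 n) (fun g : G => R.act (u, g)) 1 :=
    (R.contMDiff_act_right u).mdifferentiableAt (by simp)
  -- The factorization forces `lam 1` only into the kernel of `G → D`, so the base point in `G × G*`
  -- is `(lam 1, u)` rather than `(1, u)`.
  have h1 : B.mulMap (lam 1, u) = B.inr u := by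
    have := hev.self_of_nhds
    rw [map_one, mul_one, R.act_one] at this
    exact this.symm
  -- Both sides are differentiated at the unit. The left one yields the left-invariant field of `X`
  -- at `u`, so the `G*`-velocity on the right must be the dressing field.
  have h2 : (fun d => B.inr u * d) ∘ B.inl =ᶠ[nhds 1]
      B.mulMap ∘ fun g => (lam g, R.act (u, g)) := hev
  have h3 := mfderiv_comp_apply_of_eq (x := (1 : G)) (y := (lam 1, u))
    (B.contMDiff_mulMap.mdifferentiableAt (by simp)) (hl.prodMk ha) (by simp [R.act_one]) X
  have h4 := mfderiv_comp_apply_of_eq (I := 𝓡 n) (I' := 𝓡 (2 * n)) (I'' := 𝓡 (2 * n))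
    (g := fun d => B.inr u * d) (f := B.inl) (x := (1 : G)) (y := (1 : D))
    (contMDiff_mul_left.mdifferentiableAt (n := ∞) (by simp))
    (B.inl_smooth.mdifferentiableAt (by simp)) (map_one _) X
  rw [mfderiv_prodMk hl ha] at h3
  refine B.eq_dressingField_of_mfderiv_mulMap (X := X) (g := lam 1) (u := u)
    (v := mfderiv (𝓡 n) (𝓡 n) lam 1 X)
    (w := mfderiv (𝓡 n) (𝓡 n) (fun g : G => R.act (u, g)) 1 X) ?_
  rw [h1]
  refine h3.symm.trans (Eq.trans ?_ h4)
  rw [h2.mfderiv_eq]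
  rfl

/-- The comparison of two curves in `G*`, transported back by the dressing action. -/
theorem mfderiv_act_inv_eq {c c' : G → Gs} (hc : MDifferentiableAt (𝓡 n) (𝓡 n) c 1)
    (hc' : MDifferentiableAt (𝓡 n) (𝓡 n) c' 1) (h1 : c 1 = c' 1)
    (hd : ∀ X : GroupLieAlgebra (𝓡 n) G,
      (mfderiv (𝓡 n) (𝓡 n) c 1 X : EuclideanSpace ℝ (Fin n)) = mfderiv (𝓡 n) (𝓡 n) c' 1 X)
    (X : GroupLieAlgebra (𝓡 n) G) :
    (mfderiv (𝓡 n) (𝓡 n) (fun h => R.act (c h, h⁻¹)) 1 X : EuclideanSpace ℝ (Fin n)) =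
      mfderiv (𝓡 n) (𝓡 n) (fun h => R.act (c' h, h⁻¹)) 1 X := by
  have hi : MDifferentiableAt (𝓡 n) (𝓡 n) (fun h : G => h⁻¹) 1 :=
    (contMDiff_inv (𝓡 n) ∞).mdifferentiableAt (by simp)
  -- By the chain rule the derivative depends on `b` only through its value and differential at the
  -- unit.
  have key : ∀ {b : G → Gs}, MDifferentiableAt (𝓡 n) (𝓡 n) b 1 → b 1 = c' 1 →
      (mfderiv (𝓡 n) (𝓡 n) (fun h => R.act (b h, h⁻¹)) 1 X : EuclideanSpace ℝ (Fin n)) =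
        mfderiv ((𝓡 n).prod (𝓡 n)) (𝓡 n) R.act (c' 1, 1)
          (mfderiv (𝓡 n) (𝓡 n) b 1 X, mfderiv (𝓡 n) (𝓡 n) (fun h : G => h⁻¹) 1 X) := by
    intro b hb h
    have h3 := mfderiv_comp_apply_of_eq (x := (1 : G)) (y := (c' 1, (1 : G)))
      (R.act.contMDiff.mdifferentiableAt (by simp)) (hb.prodMk hi) (by simp [h]) X
    rw [mfderiv_prodMk hb hi] at h3
    exact h3
  rw [key hc h1, key hc' rfl]
  exact congrArg (fun v : EuclideanSpace ℝ (Fin n) =>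
    (mfderiv ((𝓡 n).prod (𝓡 n)) (𝓡 n) R.act (c' 1, 1)
      (v, mfderiv (𝓡 n) (𝓡 n) (fun h : G => h⁻¹) 1 X) : EuclideanSpace ℝ (Fin n))) (hd X)

variable {m : ℕ} {M : Type*} [TopologicalSpace M] [ChartedSpace (EuclideanSpace ℝ (Fin m)) M]
  [IsManifold (𝓡 m) ∞ M] [MulAction G M] [ContMDiffSMul (𝓡 n) (𝓡 m) ∞ G M]

theorem _root_.contMDiff_inv_smul (x : M) :
    ContMDiff (𝓡 n) (𝓡 m) ∞ (fun g : G => g⁻¹ • x) :=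
  (contMDiff_inv (𝓡 n) ∞).smul contMDiff_const

/-- A map equivariant for the infinitesimal actions of a connected group is equivariant. -/
theorem equivariant [ConnectedSpace G] (J : C^∞⟮𝓡 m, M; 𝓡 n, Gs⟯)
    (hJ : ∀ (X : GroupLieAlgebra (𝓡 n) G) (x : M),
      mfderiv (𝓡 m) (𝓡 n) J x (mfderiv (𝓡 n) (𝓡 m) (fun g : G => g⁻¹ • x) 1 X) =
        B.dressingField X (J x)) (x : M) (g : G) :
    J (g⁻¹ • x) = R.act (J x, g) := by
  have hJx : ∀ y : M, ContMDiff (𝓡 n) (𝓡 n) ∞ (fun h : G => J (h⁻¹ • y)) := fun y =>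
    J.contMDiff.comp (contMDiff_inv_smul y)
  have hF : ∀ y : M, ContMDiff (𝓡 n) (𝓡 n) ∞ (fun h : G => R.act (J (h⁻¹ • y), h⁻¹)) := fun y =>
    R.act.contMDiff.comp ((hJx y).prodMk (contMDiff_inv (𝓡 n) ∞))
  -- To first order at the unit, `J(h⁻¹ y)` may be replaced by `J(y)^h`, since both have velocity
  -- `ℓ_X(J y)`; and `(J(y)^h)^(h⁻¹)` is constant.
  have h1 : ∀ (y : M) (X : GroupLieAlgebra (𝓡 n) G),
      (mfderiv (𝓡 n) (𝓡 n) (fun h : G => R.act (J (h⁻¹ • y), h⁻¹)) 1 X :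
        EuclideanSpace ℝ (Fin n)) = 0 := by
    intro y X
    rw [R.mfderiv_act_inv_eq (c' := fun h => R.act (J y, h))
      ((hJx y).mdifferentiableAt (by simp))
      ((R.contMDiff_act_right (J y)).mdifferentiableAt (by simp)) (by simp [R.act_one])]
    · have h2 : (fun h : G => R.act (R.act (J y, h), h⁻¹)) = fun _ => J y := by
        ext1 h
        rw [← R.act_mul, mul_inv_cancel, R.act_one]
      rw [h2, mfderiv_const]
      rfl
    · intro Y
      refine Eq.trans ?_ ((hJ Y y).trans (R.mfderiv_act (J y) Y).symm)
      exact mfderiv_comp_apply_of_eq (x := (1 : G)) (y := y)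
        (J.contMDiff.mdifferentiableAt (by simp))
        ((contMDiff_inv_smul y).mdifferentiableAt (by simp)) (by simp) Y
  have h0 : ∀ k : G, mfderiv (𝓡 n) (𝓡 n) (fun h : G => R.act (J (h⁻¹ • x), h⁻¹)) k = 0 := by
    intro k
    have hl : Function.Bijective (mfderiv (𝓡 n) (𝓡 n) (fun h : G => k * h) 1) :=
      mfderiv_bijective_of_inverse (f' := fun h => k⁻¹ * h) contMDiff_mul_left contMDiff_mul_left
        (fun h => by simp) (fun h => by simp) 1
    -- Translating by `k` replaces `x` by `k⁻¹ x` and composes with the dressing action of `k⁻¹`, so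
    -- the vanishing at the unit, known for every point of `M`, gives the vanishing at `k`.
    have e : (fun h : G => R.act (J (h⁻¹ • x), h⁻¹)) ∘ (fun h => k * h) =
        (fun u => R.act (u, k⁻¹)) ∘ fun h => R.act (J (h⁻¹ • k⁻¹ • x), h⁻¹) := by
      ext1 h
      simp only [Function.comp_apply, mul_inv_rev, mul_smul, R.act_mul]
    ext1 v
    have h2 : ∀ X : GroupLieAlgebra (𝓡 n) G,
        (mfderiv (𝓡 n) (𝓡 n) (fun h : G => R.act (J (h⁻¹ • x), h⁻¹)) k
          (mfderiv (𝓡 n) (𝓡 n) (fun h : G => k * h) 1 X) : EuclideanSpace ℝ (Fin n)) = 0 := by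
      intro X
      have h3 := mfderiv_comp_apply_of_eq (x := (1 : G)) (y := k)
        ((hF x).mdifferentiableAt (by simp))
        ((contMDiff_mul_left (I := 𝓡 n) (n := ∞) (a := k)).mdifferentiableAt (by simp))
        (mul_one k) X
      have h4 := mfderiv_comp_apply (1 : G)
        ((R.contMDiff_act_left k⁻¹).mdifferentiableAt (by simp))
        ((hF (k⁻¹ • x)).mdifferentiableAt (by simp)) X
      rw [e] at h3
      refine h3.symm.trans (h4.trans ?_)
      exact (congrArg _ (h1 _ X)).trans (map_zero _)
    obtain ⟨X, hX⟩ := hl.2 v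
    refine Eq.trans ?_ (h2 X)
    exact congrArg (mfderiv (𝓡 n) (𝓡 n) (fun h : G => R.act (J (h⁻¹ • x), h⁻¹)) k) hX.symm
  -- Constancy gives `J(g⁻¹ x)^(g⁻¹) = J(x)`; acting by `g` on both sides yields the claim.
  have h5 := eq_of_mfderiv_eq_zero ((hF x).mdifferentiable (by simp)) h0 g 1
  simp only [inv_one, one_smul, R.act_one] at h5
  rw [← h5, ← R.act_mul, inv_mul_cancel, R.act_one]

/-- The coaction of a global dressing action is dual to the infinitesimal dressing action. -/
theorem isDualCoaction_coaction : IsDualCoaction B.dressingAction.hopfAction R.coaction where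
  counit f u := congrArg f (R.act_one u)
  coassoc f u g h := congrArg f (R.act_mul u g h).symm
  dual X f u := by
    rw [InfinitesimalAction.hopfAction_ι, lieDeriv]
    have h := mvfderiv_comp_apply_of_eq (1 : G) (y := u)
      (f.contMDiff.mdifferentiableAt (by simp))
      ((R.contMDiff_act_right u).mdifferentiableAt (by simp)) (R.act_one u) X
    rw [R.mfderiv_act] at h
    exact h.symm

end DoubleGroup.GlobalDressing

/-- The coaction of a group action is dual to the infinitesimal action which it generates. -/
theorem isDualCoaction_actionCoaction {n m : ℕ} {G M : Type*} [TopologicalSpace G]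
    [ChartedSpace (EuclideanSpace ℝ (Fin n)) G] [Group G] [LieGroup (𝓡 n) ∞ G]
    [TopologicalSpace M] [ChartedSpace (EuclideanSpace ℝ (Fin m)) M]
    [IsManifold (𝓡 m) ∞ M] [MulAction G M] [ContMDiffSMul (𝓡 n) (𝓡 m) ∞ G M]
    (φ : InfinitesimalAction (GroupLieAlgebra (𝓡 n) G) m M)
    (hφ : ∀ (X : GroupLieAlgebra (𝓡 n) G) (x : M),
      φ.field X x = mfderiv (𝓡 n) (𝓡 m) (fun g : G => g⁻¹ • x) 1 X) :
    IsDualCoaction φ.hopfAction (actionCoaction n G m M) where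
  counit f x := congrArg f (by simp)
  coassoc f x g h := congrArg f (by
    change h⁻¹ • g⁻¹ • x = (g * h)⁻¹ • x
    rw [mul_inv_rev, mul_smul])
  dual X f x := by
    rw [InfinitesimalAction.hopfAction_ι, lieDeriv]
    have h := mvfderiv_comp_apply_of_eq (1 : G) (y := x)
      (f.contMDiff.mdifferentiableAt (by simp))
      ((contMDiff_inv_smul x).mdifferentiableAt (by simp)) (by simp) X
    rw [← hφ] at h
    exact h.symm

end

theorem mainTheorem1 {n m : ℕ} {G Gs D M : Type*}
    [TopologicalSpace G] [ChartedSpace (EuclideanSpace ℝ (Fin n)) G] [Group G]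
    [LieGroup (𝓡 n) ∞ G] [ConnectedSpace G]
    [TopologicalSpace Gs] [ChartedSpace (EuclideanSpace ℝ (Fin n)) Gs] [Group Gs]
    [LieGroup (𝓡 n) ∞ Gs]
    [TopologicalSpace D] [ChartedSpace (EuclideanSpace ℝ (Fin (2 * n))) D] [Group D]
    [LieGroup (𝓡 (2 * n)) ∞ D]
    [TopologicalSpace M] [ChartedSpace (EuclideanSpace ℝ (Fin m)) M] [IsManifold (𝓡 m) ∞ M]
    [T2Space M] [MulAction G M] [ContMDiffSMul (𝓡 n) (𝓡 m) ∞ G M]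
    (B : DoubleGroup n G Gs D) (ε : ℤˣ) (πG : PoissonStructure n G)
    (πGs : PoissonStructure n Gs) (π : PoissonStructure m M) (U : Set Gs)
    (α : GroupLieAlgebra (𝓡 n) G →ₗ[ℝ] (Π u : Gs, (TangentSpace (𝓡 n) u →L[ℝ] ℝ)))
    (φ : InfinitesimalAction (GroupLieAlgebra (𝓡 n) G) m M)
    (J : C^∞⟮𝓡 m, M; 𝓡 n, Gs⟯)
    (hφ : IsHamiltonian B ε πG πGs π U α φ J) :
    ∃ Λ : UniversalEnvelopingAlgebra ℝ (GroupLieAlgebra (𝓡 n) G) →ₐ[ℝ]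
        Module.End ℝ C^∞⟮𝓡 n, Gs; ℝ⟯,
      (∀ (X : GroupLieAlgebra (𝓡 n) G) (f : C^∞⟮𝓡 n, Gs; ℝ⟯),
        (Λ (UniversalEnvelopingAlgebra.ι ℝ X) f : Gs → ℝ) = lieDeriv (B.dressingField X) f) ∧
      (∀ (a : UniversalEnvelopingAlgebra ℝ (GroupLieAlgebra (𝓡 n) G))
        (f : C^∞⟮𝓡 n, Gs; ℝ⟯),
        φ.hopfAction a (pullbackHom J f) = pullbackHom J (Λ a f)) ∧
      IsDualCoaction φ.hopfAction (actionCoaction n G m M) ∧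
      ∀ R : B.GlobalDressing,
        IsDualCoaction Λ R.coaction ∧
        (actionCoaction n G m M).comp (pullbackHom J) =
          (pullbackTensorId n G J).comp R.coaction := by
  refine ⟨B.dressingAction.hopfAction, B.dressingAction.hopfAction_ι,
    φ.hopfAction_pullbackHom B.dressingAction J hφ.equivariant,
    isDualCoaction_actionCoaction φ hφ.fundamental, fun R => ⟨R.isDualCoaction_coaction, ?_⟩⟩
  ext f p
  -- At `(x, g)` the two sides are `f(J(g⁻¹ x))` and `f(J(x)^g)`.
  exact congrArg f (R.equivariant J
    (fun X x => (congrArg _ (hφ.fundamental X x).symm).trans (hφ.equivariant X x)) p.1 p.2)
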